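/- Let $m\in\mathbb{N}$, let $\Sigma$ be a symmetric positive definite real $m\times m$ matrix, and let $\mathrm{N}(h,\Sigma)$ be the Gaussian distribution on $\mathbb{R}^m$ with mean $h$ and covariance $\Sigma$. Let $\|\cdot\|_1$ denote the total variation norm of signed measures (so $\|P-Q\|_1=\int|p-q|\,\mathrm{d}\mu$ when $P,Q$ have densities $p,q$ with respect to $\mu$). For a Markov kernel $\Lambda$ and a probability measure $P$ put $\Lambda(P)(A)=\int\Lambda(x,A)\,\mathrm{d}P(x)$. For an integer $r\ge 1$ define the optimal minimax $(1,r)$-cloning loss $$C_{r,\Sigma}:=\inf_{\Lambda}\sup_{h\in\mathbb{R}^m}\left\|\Lambda(\mathrm{N}(h,\Sigma))-\mathrm{N}(h,\Sigma)^{\otimes r}\right\|_1,$$ where $\Lambda$ ranges over all Markov kernels from $\mathbb{R}^m$ to $(\mathbb{R}^m)^r$, and for a real number $r\ge1$ define the optimal $r$-amplifier loss $$D_{r,\Sigma}:=\inf_{\Lambda}\sup_{h\in\mathbb{R}^m}\left\|\Lambda(\mathrm{N}(h,\Sigma))-\mathrm{N}(\sqrt r\,h,\Sigma)\right\|_1,$$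 where $\Lambda$ ranges over all Markov kernels from $\mathbb{R}^m$ to $\mathbb{R}^m$. Let $\Psi_a$ be the (deterministic) Markov kernel of the scale change $x\mapsto ax$, and let $\mathbf 1$ be the $m\times m$ identity matrix. Then for every real $r\ge 1$ $$D_{r,\Sigma}=\left\|\mathrm{N}(0,r\mathbf 1)-\mathrm{N}(0,\mathbf 1)\right\|_1;$$ in particular $D_{r,\Sigma}$ does not depend on $\Sigma$. The infimum defining $D_{r,\Sigma}$ is attained at $\Lambda=\Psi_{\sqrt r}$. Moreover, $C_{r,\Sigma}=D_{r,\Sigma}$ for every integer $r\ge1$. -/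

import Mathlib

open MeasureTheory ProbabilityTheory
open scoped ENNReal

noncomputable section

namespace GaussianCloning

/-- The total variation norm `‖P - Q‖₁` of the signed measure `P - Q`. For measures with densities
`p`, `q` it equals `∫ |p - q|`; between probability measures it ranges over `[0, 2]`. -/
def l1Dist {X : Type*} [MeasurableSpace X] (P Q : Measure X) [IsFiniteMeasure P]
    [IsFiniteMeasure Q] : ℝ≥0∞ :=
  (P.toSignedMeasure - Q.toSignedMeasure).totalVariation Set.univ

variable {m : ℕ}

/-- The worst-case loss over the shifts `h ∈ ℝᵐ` of a Markov map `Λ` as an approximate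
`(1, r)`-cloner: `sup_h ‖Λ(N(h, S)) - N(h, S)^{⊗ r}‖₁`. -/
def cloningLoss (r : ℕ) (S : Matrix (Fin m) (Fin m) ℝ)
    (Λ : Kernel (EuclideanSpace ℝ (Fin m)) (Fin r → EuclideanSpace ℝ (Fin m)))
    [IsMarkovKernel Λ] : ℝ≥0∞ :=
  ⨆ h : EuclideanSpace ℝ (Fin m),
    l1Dist ((multivariateGaussian h S).bind Λ)
      (Measure.pi fun _ : Fin r => multivariateGaussian h S)

/-- The optimal minimax `(1, r)`-cloning loss: the infimum over all Markov maps. -/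
def optCloningLoss (r : ℕ) (S : Matrix (Fin m) (Fin m) ℝ) : ℝ≥0∞ :=
  ⨅ (Λ : Kernel (EuclideanSpace ℝ (Fin m)) (Fin r → EuclideanSpace ℝ (Fin m)))
    (_ : IsMarkovKernel Λ), cloningLoss r S Λ

/-- The worst-case loss over the shifts `h ∈ ℝᵐ` of a Markov map `Λ` as an `r`-amplifier:
`sup_h ‖Λ(N(h, S)) - N(√r h, S)‖₁`. -/
def amplifierLoss (r : ℝ) (S : Matrix (Fin m) (Fin m) ℝ)
    (Λ : Kernel (EuclideanSpace ℝ (Fin m)) (EuclideanSpace ℝ (Fin m)))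
    [IsMarkovKernel Λ] : ℝ≥0∞ :=
  ⨆ h : EuclideanSpace ℝ (Fin m),
    l1Dist ((multivariateGaussian h S).bind Λ) (multivariateGaussian (Real.sqrt r • h) S)

/-- The optimal `r`-amplifier loss: the infimum over all Markov maps. -/
def optAmplifierLoss (r : ℝ) (S : Matrix (Fin m) (Fin m) ℝ) : ℝ≥0∞ :=
  ⨅ (Λ : Kernel (EuclideanSpace ℝ (Fin m)) (EuclideanSpace ℝ (Fin m)))
    (_ : IsMarkovKernel Λ), amplifierLoss r S Λ

/-- The Markov map of the change of scale `x ↦ a x`. -/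
def scaling (m : ℕ) (a : ℝ) :
    Kernel (EuclideanSpace ℝ (Fin m)) (EuclideanSpace ℝ (Fin m)) :=
  Kernel.deterministic (fun x => a • x) (measurable_const_smul a)

instance (m : ℕ) (a : ℝ) : IsMarkovKernel (scaling m a) := by
  unfold scaling; infer_instance

end GaussianCloning

end

/-! Upper bound: scaling by `√r` sends `N(h, Σ)` to `N(√r h, rΣ)`. This law and `N(√r h, Σ)` are the
images of `N(0, r𝟏)` and `N(0, 𝟏)` under one affine map, so the loss is at most the claimed value
for every `h`.

Lower bound (`l1Dist_le_of_forall_l1Dist_le`): replace the supremum over `h` by an average over a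
Gaussian prior and test the output on a ball around the target mean. Given the observation, the
shift is still Gaussian, so by `stdGaussian_closedBall_le` no output rule hits the ball more often
than a centred one (`lintegral_prior_le`). As the prior flattens, the ball of radius `ρ` shrinks to
radius `ρ / √r`, which is exactly what scaling achieves. The region where the density of `N(0, 𝟏)`
dominates that of `N(0, r𝟏)` is itself a centred ball, so balls are the optimal tests.

Cloning: the normalized sum is sufficient for `h`. Markov maps between `N(√r h, Σ)` and `N(h,
Σ)^{⊗r}` exist in both directions, and they contract total variation. -/

noncomputable section

namespace GaussianCloning

/-! ### Total variation as a supremum over tests. -/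

section L1Dist

variable {X Y : Type*} [MeasurableSpace X] [MeasurableSpace Y]

/-- The Jordan decomposition of the difference of two probability measures, and its relation to the
total variation norm. -/
theorem exists_add_eq_add (P Q : Measure X) [IsProbabilityMeasure P] [IsProbabilityMeasure Q] :
    ∃ μ ν : Measure X, P + ν = Q + μ ∧ l1Dist P Q = 2 * ν Set.univ ∧
      ∃ A, MeasurableSet A ∧ μ A = 0 ∧ ν A = ν Set.univ := by
  set j := (P.toSignedMeasure - Q.toSignedMeasure).toJordanDecomposition with hj
  have hspec : j.posPart.toSignedMeasure - j.negPart.toSignedMeasure =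
      P.toSignedMeasure - Q.toSignedMeasure :=
    SignedMeasure.toSignedMeasure_toJordanDecomposition _
  have hadd : P + j.negPart = Q + j.posPart := by
    rw [← Measure.toSignedMeasure_eq_toSignedMeasure_iff, Measure.toSignedMeasure_add,
      Measure.toSignedMeasure_add, add_comm Q.toSignedMeasure]
    exact (sub_eq_sub_iff_add_eq_add.1 hspec).symm
  have huniv : j.negPart Set.univ = j.posPart Set.univ := by
    have : P Set.univ + j.negPart Set.univ = Q Set.univ + j.posPart Set.univ := by
      simpa only [Measure.add_apply] using congrArg (fun μ : Measure X => μ Set.univ) hadd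
    rw [measure_univ (μ := P), measure_univ (μ := Q)] at this
    exact (ENNReal.add_right_inj ENNReal.one_ne_top).1 this
  refine ⟨j.posPart, j.negPart, hadd, ?_, ?_⟩
  · rw [l1Dist, SignedMeasure.totalVariation, Measure.add_apply, ← hj, ← huniv, two_mul]
  · obtain ⟨A, hA, h0, h1⟩ := j.mutuallySingular
    exact ⟨A, hA, h0, by rw [← measure_add_measure_compl hA, h1, add_zero]⟩

/-- The two Jordan parts have equal mass, whence the factor 2 and the sufficiency of one-sided
tests; the extremal test is the set carrying the negative part. -/
theorem l1Dist_le_two_mul_iff (P Q : Measure X) [IsProbabilityMeasure P] [IsProbabilityMeasure Q]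
    (c : ℝ≥0∞) :
    l1Dist P Q ≤ 2 * c ↔ ∀ A, MeasurableSet A → Q A ≤ P A + c := by
  obtain ⟨μ, ν, hadd, hdist, A₀, hA₀, hμ, hν⟩ := exists_add_eq_add P Q
  have happ (A : Set X) : P A + ν A = Q A + μ A := by
    simpa only [Measure.add_apply] using congrArg (fun μ : Measure X => μ A) hadd
  rw [hdist, ENNReal.mul_le_mul_iff_right two_ne_zero ENNReal.ofNat_ne_top]
  constructor
  · intro h A _
    calc Q A ≤ Q A + μ A := le_self_add
      _ = P A + ν A := (happ A).symm
      _ ≤ P A + c := by gcongr; exact (measure_mono (Set.subset_univ _)).trans h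
  · intro h
    have hQ := happ A₀
    rw [hμ, add_zero, hν] at hQ
    have := h A₀ hA₀
    rw [← hQ] at this
    exact (ENNReal.add_le_add_iff_left (measure_ne_top P A₀)).1 this

theorem l1Dist_self (P : Measure X) [IsProbabilityMeasure P] : l1Dist P P = 0 := by
  simpa using (l1Dist_le_two_mul_iff P P 0).2 (by simp)

/-- Markov kernels contract the total variation norm. -/
theorem l1Dist_bind_le (P Q : Measure X) [IsProbabilityMeasure P] [IsProbabilityMeasure Q]
    (K : Kernel X Y) [IsMarkovKernel K] (P' Q' : Measure Y) [IsProbabilityMeasure P']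
    [IsProbabilityMeasure Q'] (hP : P' = P.bind K) (hQ : Q' = Q.bind K) :
    l1Dist P' Q' ≤ l1Dist P Q := by
  obtain ⟨μ, ν, hadd, hdist, -⟩ := exists_add_eq_add P Q
  rw [hdist, l1Dist_le_two_mul_iff]
  intro A hA
  rw [hP, hQ, Measure.bind_apply hA K.aemeasurable, Measure.bind_apply hA K.aemeasurable]
  calc ∫⁻ x, K x A ∂Q ≤ ∫⁻ x, K x A ∂(Q + μ) :=
        lintegral_mono' (Measure.le_add_right le_rfl) le_rfl
    _ = ∫⁻ x, K x A ∂P + ∫⁻ x, K x A ∂ν := by rw [← hadd, lintegral_add_measure]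
    _ ≤ ∫⁻ x, K x A ∂P + ∫⁻ _, 1 ∂ν := by gcongr; exact prob_le_one
    _ = _ := by rw [lintegral_one]

theorem l1Dist_map_le (P Q : Measure X) [IsProbabilityMeasure P] [IsProbabilityMeasure Q]
    {f : X → Y} (hf : Measurable f) (P' Q' : Measure Y) [IsProbabilityMeasure P']
    [IsProbabilityMeasure Q'] (hP : P' = P.map f) (hQ : Q' = Q.map f) :
    l1Dist P' Q' ≤ l1Dist P Q :=
  l1Dist_bind_le P Q (Kernel.deterministic f hf) P' Q'
    (by rw [Measure.deterministic_comp_eq_map, hP]) (by rw [Measure.deterministic_comp_eq_map, hQ])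

/-- The total variation norm of a difference of measures with densities `p`, `q` is governed by the
likelihood ratio set `{p ≤ q}`. -/
theorem l1Dist_withDensity_le (μ : Measure X) {p q : X → ℝ≥0∞} (hp : Measurable p)
    (hq : Measurable q) (P Q : Measure X) [IsProbabilityMeasure P] [IsProbabilityMeasure Q]
    (hP : P = μ.withDensity p) (hQ : Q = μ.withDensity q) {c : ℝ≥0∞}
    (h : Q {x | p x ≤ q x} ≤ P {x | p x ≤ q x} + c) : l1Dist P Q ≤ 2 * c := by
  rw [l1Dist_le_two_mul_iff]
  intro A hA
  set B := {x | p x ≤ q x}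
  have hB : MeasurableSet B := measurableSet_le hp hq
  -- Neyman–Pearson: dropping points outside `B` or adding points of `B` never decreases `Q - P`, so
  -- `B` is the worst test.
  have h1 : Q (A \ B) ≤ P (A \ B) := by
    rw [hP, hQ, withDensity_apply _ (hA.diff hB), withDensity_apply _ (hA.diff hB)]
    exact setLIntegral_mono' (hA.diff hB) fun x hx => (not_le.1 hx.2).le
  have h2 : P (B \ A) ≤ Q (B \ A) := by
    rw [hP, hQ, withDensity_apply _ (hB.diff hA), withDensity_apply _ (hB.diff hA)]
    exact setLIntegral_mono' (hB.diff hA) fun x hx => hx.1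
  rw [← measure_inter_add_sdiff B hA (μ := Q), ← measure_inter_add_sdiff B hA (μ := P),
    Set.inter_comm] at h
  have h3 : Q (A ∩ B) ≤ P (A ∩ B) + c := by
    refine (ENNReal.add_le_add_iff_right (measure_ne_top P (B \ A))).1 ?_
    calc Q (A ∩ B) + P (B \ A) ≤ Q (A ∩ B) + Q (B \ A) := by gcongr
      _ ≤ P (A ∩ B) + P (B \ A) + c := h
      _ = P (A ∩ B) + c + P (B \ A) := by ring
  calc Q A = Q (A ∩ B) + Q (A \ B) := (measure_inter_add_sdiff A hB).symm
    _ ≤ P (A ∩ B) + c + P (A \ B) := by gcongr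
    _ = P (A ∩ B) + P (A \ B) + c := by ring
    _ = P A + c := by rw [measure_inter_add_sdiff A hB]

end L1Dist

/-! ### Isotropic Gaussian densities and balls. -/

section Gaussian

variable {E : Type*} [NormedAddCommGroup E] [InnerProductSpace ℝ E]

variable (E) in
/-- The normalizing constant of the centred Gaussian density with covariance `r • 1`. -/
def gaussianConst (r : ℝ) : ℝ := (2 * Real.pi * r) ^ (-(Module.finrank ℝ E : ℝ) / 2)

/-- The density of the centred Gaussian measure with covariance `r • 1`. -/
def gaussianDensity (r : ℝ) (x : E) : ℝ :=
  gaussianConst E r * Real.exp (-(2 * r)⁻¹ * ‖x‖ ^ 2)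

variable (E) in
theorem gaussianConst_pos {r : ℝ} (hr : 0 < r) : 0 < gaussianConst E r :=
  Real.rpow_pos_of_pos (by positivity) _

theorem gaussianDensity_nonneg {r : ℝ} (hr : 0 < r) (x : E) : 0 ≤ gaussianDensity r x :=
  mul_nonneg (gaussianConst_pos E hr).le (Real.exp_pos _).le

theorem gaussianDensity_anti {r : ℝ} (hr : 0 < r) {x y : E} (h : ‖x‖ ≤ ‖y‖) :
    gaussianDensity r y ≤ gaussianDensity r x := by
  unfold gaussianDensity
  have := gaussianConst_pos E hr
  have h2 : ‖x‖ ^ 2 ≤ ‖y‖ ^ 2 := by gcongr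
  have : 0 ≤ (2 * r)⁻¹ := by positivity
  gcongr ?_ * Real.exp ?_
  nlinarith

variable (E) in
/-- The set where the standard Gaussian density dominates a wider one is a centred ball. -/
theorem exists_closedBall_eq_setOf_gaussianDensity_le {r : ℝ} (hr : 1 < r) :
    ∃ ρ, 0 ≤ ρ ∧ {x : E | ENNReal.ofReal (gaussianDensity r x) ≤
      ENNReal.ofReal (gaussianDensity 1 x)} = Metric.closedBall 0 ρ := by
  have hr0 : 0 < r := by linarith
  have hc1 := gaussianConst_pos E one_pos
  have hcr := gaussianConst_pos E hr0
  have hle : gaussianConst E r ≤ gaussianConst E 1 := by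
    unfold gaussianConst
    apply Real.rpow_le_rpow_of_nonpos (by positivity)
    · have := Real.pi_pos
      nlinarith
    · have : (0 : ℝ) ≤ Module.finrank ℝ E := by positivity
      linarith
  have hd : 0 < 2⁻¹ - (2 * r)⁻¹ := by
    rw [sub_pos]
    exact inv_strictAnti₀ two_pos (by linarith)
  -- Taking logarithms makes the density comparison read `‖x‖² ≤ K`; `K ≥ 0` because the wider
  -- Gaussian has the smaller normalizing constant.
  set K := (Real.log (gaussianConst E 1) - Real.log (gaussianConst E r)) / (2⁻¹ - (2 * r)⁻¹)
  have hK : 0 ≤ K := div_nonneg (sub_nonneg.2 (Real.log_le_log hcr hle)) hd.le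
  refine ⟨Real.sqrt K, Real.sqrt_nonneg K, ?_⟩
  ext x
  rw [Set.mem_ofPred_eq, ENNReal.ofReal_le_ofReal_iff (gaussianDensity_nonneg one_pos x),
    Metric.mem_closedBall, dist_zero_right, Real.le_sqrt (norm_nonneg x) hK, le_div_iff₀ hd,
    gaussianDensity, gaussianDensity,
    ← Real.log_le_log_iff (by positivity) (by positivity),
    Real.log_mul hcr.ne' (Real.exp_pos _).ne', Real.log_mul hc1.ne' (Real.exp_pos _).ne',
    Real.log_exp, Real.log_exp, mul_one]
  constructor <;> intro h <;> linarith

variable [MeasurableSpace E] [BorelSpace E]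

theorem measurable_gaussianDensity (r : ℝ) : Measurable (gaussianDensity r : E → ℝ) := by
  unfold gaussianDensity; fun_prop

variable [FiniteDimensional ℝ E]

instance (a : ℝ) : IsProbabilityMeasure ((stdGaussian E).map (fun x => a • x)) :=
  Measure.isProbabilityMeasure_map (measurable_const_smul a).aemeasurable

theorem integrable_gaussianDensity {r : ℝ} (hr : 0 < r) :
    Integrable (gaussianDensity r : E → ℝ) := by
  have h := (GaussianFourier.integrable_cexp_neg_mul_sq_norm_add (V := E)
    (b := ((2 * r)⁻¹ : ℝ)) (by rw [Complex.ofReal_re]; positivity) 0 0).re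
  refine (h.const_mul (gaussianConst E r)).congr (.of_forall fun x => ?_)
  simp only [gaussianDensity, zero_mul, add_zero]
  congr 1
  rw [← Complex.ofReal_neg, ← Complex.ofReal_pow, ← Complex.ofReal_mul, ← Complex.ofReal_exp]
  exact Complex.ofReal_re _

theorem map_smul_stdGaussian_eq_withDensity {r : ℝ} (hr : 0 < r) :
    (stdGaussian E).map (fun x => Real.sqrt r • x) =
      volume.withDensity (fun x => ENNReal.ofReal (gaussianDensity r x)) := by
  have := isFiniteMeasure_withDensity_ofReal (integrable_gaussianDensity (E := E) hr).2
  refine Measure.ext_of_charFun (funext fun t => ?_)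
  rw [charFun_map_smul, charFun_stdGaussian, charFun_apply,
    integral_withDensity_eq_integral_toReal_smul
      (measurable_gaussianDensity r).ennreal_ofReal (by simp)]
  have hb : 0 < (((2 * r)⁻¹ : ℝ) : ℂ).re := by rw [Complex.ofReal_re]; positivity
  have key (x : E) : (ENNReal.ofReal (gaussianDensity r x)).toReal •
      Complex.exp (inner ℝ x t * Complex.I) = (gaussianConst E r : ℂ) *
        Complex.exp (-(((2 * r)⁻¹ : ℝ) : ℂ) * ‖x‖ ^ 2 + Complex.I * inner ℝ t x) := by
    rw [ENNReal.toReal_ofReal (gaussianDensity_nonneg hr x), gaussianDensity, Complex.real_smul,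
      Complex.exp_add, Complex.ofReal_mul, Complex.ofReal_exp, real_inner_comm,
      mul_comm Complex.I, mul_assoc]
    push_cast
    rfl
  simp_rw [key]
  rw [integral_const_mul, GaussianFourier.integral_cexp_neg_mul_sq_norm_add hb,
    ← Complex.ofReal_div, ← mul_assoc]
  have hc : (gaussianConst E r : ℂ) *
      ((Real.pi / (2 * r)⁻¹ : ℝ) : ℂ) ^ ((Module.finrank ℝ E : ℂ) / 2) = 1 := by
    have h1 : ((Module.finrank ℝ E : ℂ) / 2) = (((Module.finrank ℝ E : ℝ) / 2 : ℝ) : ℂ) := by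
      push_cast; rfl
    rw [h1, ← Complex.ofReal_cpow (by positivity), ← Complex.ofReal_mul, gaussianConst,
      div_inv_eq_mul, show Real.pi * (2 * r) = 2 * Real.pi * r by ring, neg_div,
      ← Real.rpow_add (by positivity), neg_add_cancel, Real.rpow_zero, Complex.ofReal_one]
  rw [hc, one_mul, ← Complex.ofReal_pow, norm_smul, mul_pow, Real.norm_eq_abs, sq_abs,
    Real.sq_sqrt hr.le, Complex.I_sq]
  congr 1
  have : (r : ℂ) ≠ 0 := by exact_mod_cast hr.ne'
  push_cast
  field_simp
  ring

theorem stdGaussian_eq_withDensity :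
    stdGaussian E = volume.withDensity (fun x => ENNReal.ofReal (gaussianDensity 1 x)) := by
  simpa using map_smul_stdGaussian_eq_withDensity (E := E) one_pos

/-- Among the balls of a given radius, the centred one has the largest Gaussian measure. -/
theorem stdGaussian_closedBall_le (y : E) (ρ : ℝ) :
    stdGaussian E (Metric.closedBall y ρ) ≤ stdGaussian E (Metric.closedBall 0 ρ) := by
  obtain hρ | hρ := lt_or_ge ρ 0
  · simp [Metric.closedBall_eq_empty.2 hρ]
  set B := Metric.closedBall y ρ
  set B₀ := Metric.closedBall (0 : E) ρ
  have hB : MeasurableSet B := Metric.isClosed_closedBall.measurableSet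
  have hB₀ : MeasurableSet B₀ := Metric.isClosed_closedBall.measurableSet
  rw [← measure_inter_add_sdiff B hB₀, ← measure_inter_add_sdiff B₀ hB, Set.inter_comm]
  gcongr _ + ?_
  have hvol : volume (B \ B₀) = volume (B₀ \ B) := by
    have h : volume B = volume B₀ := Measure.addHaar_closedBall_center volume y ρ
    rw [← measure_inter_add_sdiff B hB₀, ← measure_inter_add_sdiff B₀ hB, Set.inter_comm] at h
    refine (ENNReal.add_right_inj ?_).1 h
    exact ((measure_mono Set.inter_subset_left).trans_lt measure_closedBall_lt_top).ne
  -- The density at a point `e` of norm `ρ` separates its values inside `B₀` from those outside, and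
  -- the two differences have equal volume. Only a nontrivial space is sure to contain such an `e`.
  obtain hE | hE := subsingleton_or_nontrivial E
  · have : B = B₀ := by simp [B, B₀, Subsingleton.elim y 0]
    simp [this]
  obtain ⟨e, he⟩ := exists_norm_eq E hρ
  rw [stdGaussian_eq_withDensity, withDensity_apply _ (hB.diff hB₀),
    withDensity_apply _ (hB₀.diff hB)]
  calc ∫⁻ x in B \ B₀, ENNReal.ofReal (gaussianDensity 1 x)
      ≤ ∫⁻ _ in B \ B₀, ENNReal.ofReal (gaussianDensity 1 e) :=
        setLIntegral_mono' (hB.diff hB₀) fun x hx => ENNReal.ofReal_le_ofReal <|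
          gaussianDensity_anti one_pos <| by
            have := hx.2
            simp only [B₀, Metric.mem_closedBall, dist_zero_right, not_le] at this
            linarith
    _ = ∫⁻ _ in B₀ \ B, ENNReal.ofReal (gaussianDensity 1 e) := by simp [hvol]
    _ ≤ ∫⁻ x in B₀ \ B, ENNReal.ofReal (gaussianDensity 1 x) :=
        setLIntegral_mono' (hB₀.diff hB) fun x hx => ENNReal.ofReal_le_ofReal <|
          gaussianDensity_anti one_pos <| by
            have := hx.1
            simp only [B₀, Metric.mem_closedBall, dist_zero_right] at this
            linarith

end Gaussian

/-! ### The Bayesian lower bound. -/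

section LowerBound

variable {E : Type*} [NormedAddCommGroup E] [InnerProductSpace ℝ E]

theorem add_smul_mem_closedBall_iff {a : ℝ} (ha : 0 < a) (x y : E) (ρ : ℝ) :
    y + a • x ∈ Metric.closedBall 0 ρ ↔ x ∈ Metric.closedBall (-(a⁻¹ • y)) (ρ / a) := by
  rw [Metric.mem_closedBall, Metric.mem_closedBall, dist_zero_right, dist_eq_norm, le_div_iff₀ ha,
    sub_neg_eq_add, mul_comm]
  conv_rhs => rw [← abs_of_pos ha, ← Real.norm_eq_abs, ← norm_smul, smul_add, smul_smul,
    Real.norm_eq_abs, abs_of_pos ha, mul_inv_cancel₀ ha.ne', one_smul, add_comm]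

variable [FiniteDimensional ℝ E] [MeasurableSpace E] [BorelSpace E]

instance (h : E) (A : E ≃L[ℝ] E) :
    IsProbabilityMeasure ((stdGaussian E).map (fun x => h + A x)) :=
  Measure.isProbabilityMeasure_map (by fun_prop)

variable (Λ : Kernel E E) [IsMarkovKernel Λ] (A : E ≃L[ℝ] E)

/-- Averaging the probability of hitting a moving ball against a Gaussian prior on the shift. -/
theorem lintegral_prior_le {θ r ρ : ℝ} (hθ : 0 < Real.sin θ) (hθ' : 0 < Real.cos θ) (hr : 0 < r) :
    ∫⁻ p : E × E, Λ (A ((Real.cos θ / Real.sin θ) • p.1 + p.2))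
      {w | A.symm w - Real.sqrt r • (Real.cos θ / Real.sin θ) • p.1 ∈ Metric.closedBall 0 ρ}
        ∂((stdGaussian E).prod (stdGaussian E)) ≤
      stdGaussian E (Metric.closedBall 0 (ρ / (Real.sqrt r * Real.cos θ))) := by
  set γ := stdGaussian E
  set c := Real.cos θ
  set s := Real.sin θ
  have hrot : (γ.prod γ).map (ContinuousLinearMap.rotation (-θ)) = γ.prod γ :=
    IsGaussian.map_rotation_eq_self (by simp [γ]) (-θ)
  have hmeas : Measurable fun p : E × E => Λ (A ((c / s) • p.1 + p.2))
      {w | A.symm w - Real.sqrt r • (c / s) • p.1 ∈ Metric.closedBall 0 ρ} := by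
    have hg : Measurable fun p : E × E => A ((c / s) • p.1 + p.2) := by fun_prop
    have hT : MeasurableSet {q : (E × E) × E |
        A.symm q.2 - Real.sqrt r • (c / s) • q.1.1 ∈ Metric.closedBall 0 ρ} :=
      Metric.isClosed_closedBall.measurableSet.preimage (by fun_prop)
    exact Kernel.measurable_kernel_prodMk_left (κ := Λ.comap _ hg) hT
  -- In rotated coordinates the observation depends on `p.1` alone, while the target still involves
  -- the independent `p.2`, with coefficient `√r (c / s) s = √r c`.
  rw [← hrot, lintegral_map hmeas (by fun_prop)]
  have hcs : c * c + s * s = 1 := by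
    have := Real.cos_sq_add_sin_sq θ
    nlinarith
  have hpt (p : E × E) : Λ (A ((c / s) • (ContinuousLinearMap.rotation (-θ) p).1 +
        (ContinuousLinearMap.rotation (-θ) p).2))
      {w | A.symm w - Real.sqrt r • (c / s) • (ContinuousLinearMap.rotation (-θ) p).1 ∈
        Metric.closedBall 0 ρ} = Λ (A (s⁻¹ • p.1))
      {w | (A.symm w - (Real.sqrt r * (c * c / s)) • p.1) + (Real.sqrt r * c) • p.2 ∈
        Metric.closedBall 0 ρ} := by
    have h1 : (ContinuousLinearMap.rotation (-θ) p).1 = c • p.1 - s • p.2 := by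
      simp [ContinuousLinearMap.rotation_apply, c, s, sub_eq_add_neg]
    have h2 : (ContinuousLinearMap.rotation (-θ) p).2 = s • p.1 + c • p.2 := by
      simp [ContinuousLinearMap.rotation_apply, c, s]
    have h3 : (c / s) • (c • p.1 - s • p.2) + (s • p.1 + c • p.2) = s⁻¹ • p.1 := by
      match_scalars
      · field_simp
        linarith
      · field_simp
        ring
    have h4 (w : E) : A.symm w - Real.sqrt r • (c / s) • (c • p.1 - s • p.2) =
        (A.symm w - (Real.sqrt r * (c * c / s)) • p.1) + (Real.sqrt r * c) • p.2 := by
      match_scalars <;> field_simp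
    simp_rw [h1, h2, h3, h4]
  simp_rw [hpt]
  have hmeas' : Measurable fun p : E × E => Λ (A (s⁻¹ • p.1))
      {w | (A.symm w - (Real.sqrt r * (c * c / s)) • p.1) + (Real.sqrt r * c) • p.2 ∈
        Metric.closedBall 0 ρ} := by
    have hg : Measurable fun p : E × E => A (s⁻¹ • p.1) := by fun_prop
    have hT : MeasurableSet {q : (E × E) × E |
        (A.symm q.2 - (Real.sqrt r * (c * c / s)) • q.1.1) + (Real.sqrt r * c) • q.1.2 ∈
          Metric.closedBall 0 ρ} :=
      Metric.isClosed_closedBall.measurableSet.preimage (by fun_prop)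
    exact Kernel.measurable_kernel_prodMk_left (κ := Λ.comap _ hg) hT
  rw [lintegral_prod _ hmeas'.aemeasurable]
  have ha : 0 < Real.sqrt r * c := mul_pos (Real.sqrt_pos.2 hr) hθ'
  refine (lintegral_mono (g := fun _ => γ (Metric.closedBall 0 (ρ / (Real.sqrt r * c))))
    fun x => ?_).trans (by simp)
  set ν := Λ (A (s⁻¹ • x))
  have hT : MeasurableSet {q : E × E |
      (A.symm q.2 - (Real.sqrt r * (c * c / s)) • x) + (Real.sqrt r * c) • q.1 ∈
        Metric.closedBall 0 ρ} :=
    Metric.isClosed_closedBall.measurableSet.preimage (by fun_prop)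
  calc _ = (γ.prod ν) {q : E × E |
      (A.symm q.2 - (Real.sqrt r * (c * c / s)) • x) + (Real.sqrt r * c) • q.1 ∈
        Metric.closedBall 0 ρ} := (Measure.prod_apply hT).symm
    _ ≤ _ := by
      -- With the output `w` fixed, the Gaussian variable must fall in a ball of radius `ρ / (√r c)`
      -- whose centre depends on `w`; centring it only helps.
      rw [Measure.prod_apply_symm hT]
      refine (lintegral_mono (g := fun _ => γ (Metric.closedBall 0 (ρ / (Real.sqrt r * c))))
        fun w => ?_).trans (by simp)
      simp only [Set.preimage_ofPred_eq, add_smul_mem_closedBall_iff ha]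
      exact stdGaussian_closedBall_le _ _

variable {Λ A}

/-- The shift is `A (a • u)` with `u` standard Gaussian and `a = cot θ`: small `θ` means a flat
prior. The tested set is the `A`-image of a `ρ`-ball about `√r a u`, to which the target law gives
the mass of a centred `ρ`-ball. -/
theorem stdGaussian_closedBall_le_div_sqrt_mul_cos {r ρ : ℝ} (hr : 0 < r) {c : ℝ≥0∞}
    (hc : ∀ h : E, l1Dist (((stdGaussian E).map fun x => h + A x).bind Λ)
      ((stdGaussian E).map fun x => Real.sqrt r • h + A x) ≤ 2 * c)
    {θ : ℝ} (hθ : 0 < Real.sin θ) (hθ' : 0 < Real.cos θ) :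
    stdGaussian E (Metric.closedBall 0 ρ) ≤
      stdGaussian E (Metric.closedBall 0 (ρ / (Real.sqrt r * Real.cos θ))) + c := by
  set γ := stdGaussian E
  set a := Real.cos θ / Real.sin θ
  have hball (u : E) : γ (Metric.closedBall 0 ρ) ≤ ∫⁻ z, Λ (A (a • u + z))
      {w | A.symm w - Real.sqrt r • a • u ∈ Metric.closedBall 0 ρ} ∂γ + c := by
    have hT : MeasurableSet {w : E | A.symm w - Real.sqrt r • a • u ∈ Metric.closedBall 0 ρ} :=
      Metric.isClosed_closedBall.measurableSet.preimage (by fun_prop)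
    have h := (l1Dist_le_two_mul_iff _ _ c).1 (hc (A (a • u))) _ hT
    rw [Measure.map_apply (by fun_prop) hT, Measure.bind_apply hT Λ.aemeasurable,
      lintegral_map (Λ.measurable_coe hT) (by fun_prop)] at h
    convert h using 3
    · ext z
      simp
    · simp
  have hmeas : Measurable fun p : E × E => Λ (A (a • p.1 + p.2))
      {w | A.symm w - Real.sqrt r • a • p.1 ∈ Metric.closedBall 0 ρ} := by
    have hg : Measurable fun p : E × E => A (a • p.1 + p.2) := by fun_prop
    have hT : MeasurableSet {q : (E × E) × E |
        A.symm q.2 - Real.sqrt r • a • q.1.1 ∈ Metric.closedBall 0 ρ} :=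
      Metric.isClosed_closedBall.measurableSet.preimage (by fun_prop)
    exact Kernel.measurable_kernel_prodMk_left (κ := Λ.comap _ hg) hT
  calc γ (Metric.closedBall 0 ρ) = ∫⁻ _, γ (Metric.closedBall 0 ρ) ∂γ := by simp
    _ ≤ ∫⁻ u, (∫⁻ z, Λ (A (a • u + z))
      {w | A.symm w - Real.sqrt r • a • u ∈ Metric.closedBall 0 ρ} ∂γ + c) ∂γ :=
        lintegral_mono hball
    _ = ∫⁻ u, ∫⁻ z, Λ (A (a • u + z))
      {w | A.symm w - Real.sqrt r • a • u ∈ Metric.closedBall 0 ρ} ∂γ ∂γ + c := by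
        rw [lintegral_add_right _ measurable_const]
        simp
    _ ≤ _ := by
        rw [← lintegral_prod _ hmeas.aemeasurable]
        gcongr
        exact lintegral_prior_le Λ A hθ hθ' hr

/-- Limit `θ → 0⁺`: the larger balls are closed thickenings of the limiting closed ball, so their
measures converge to its measure. -/
theorem stdGaussian_closedBall_le_div_sqrt {r ρ : ℝ} (hr : 0 < r) (hρ : 0 ≤ ρ)
    {c : ℝ≥0∞} (hc : ∀ h : E, l1Dist (((stdGaussian E).map fun x => h + A x).bind Λ)
      ((stdGaussian E).map fun x => Real.sqrt r • h + A x) ≤ 2 * c) :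
    stdGaussian E (Metric.closedBall 0 ρ) ≤
      stdGaussian E (Metric.closedBall 0 (ρ / Real.sqrt r)) + c := by
  have hs : 0 < Real.sqrt r := Real.sqrt_pos.2 hr
  have hlim : Filter.Tendsto (fun θ => ρ / (Real.sqrt r * Real.cos θ) - ρ / Real.sqrt r)
      (nhdsWithin 0 (Set.Ioi 0)) (nhds 0) := by
    have h : ContinuousAt (fun θ => ρ / (Real.sqrt r * Real.cos θ) - ρ / Real.sqrt r) 0 := by
      refine ContinuousAt.sub (ContinuousAt.div (by fun_prop) (by fun_prop) ?_) (by fun_prop)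
      simpa using hs.ne'
    have h' := h.tendsto.mono_left (nhdsWithin_le_nhds (s := Set.Ioi 0))
    simpa using h'
  have hmeas := (tendsto_measure_cthickening_of_isClosed (μ := stdGaussian E)
    (s := Metric.closedBall 0 (ρ / Real.sqrt r)) ⟨1, one_pos, measure_ne_top _ _⟩
    Metric.isClosed_closedBall).comp hlim
  refine ge_of_tendsto (hmeas.add tendsto_const_nhds) ?_
  filter_upwards [Ioo_mem_nhdsGT (show (0 : ℝ) < Real.pi / 2 by positivity)] with θ hθ
  have hsin : 0 < Real.sin θ :=
    Real.sin_pos_of_pos_of_lt_pi hθ.1 (by linarith [hθ.2, Real.pi_pos])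
  have hcos : 0 < Real.cos θ := Real.cos_pos_of_mem_Ioo ⟨by linarith [hθ.1, Real.pi_pos], hθ.2⟩
  have hle : ρ / Real.sqrt r ≤ ρ / (Real.sqrt r * Real.cos θ) :=
    div_le_div_of_nonneg_left hρ (by positivity) (mul_le_of_le_one_right hs.le (Real.cos_le_one θ))
  rw [Function.comp_apply, cthickening_closedBall (by linarith) (by positivity), sub_add_cancel]
  exact stdGaussian_closedBall_le_div_sqrt_mul_cos hr hc hsin hcos

/-- A minimax lower bound: no Markov kernel amplifies better than the change of scale. -/
theorem l1Dist_le_of_forall_l1Dist_le {r : ℝ} (hr : 1 ≤ r) {c : ℝ≥0∞}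
    (hc : ∀ h : E, l1Dist (((stdGaussian E).map fun x => h + A x).bind Λ)
      ((stdGaussian E).map fun x => Real.sqrt r • h + A x) ≤ 2 * c) :
    l1Dist ((stdGaussian E).map fun x => Real.sqrt r • x) (stdGaussian E) ≤ 2 * c := by
  -- For `r = 1` the densities coincide and the dominance region need not be a ball.
  obtain rfl | hr1 := hr.eq_or_lt
  · simp [l1Dist_self]
  have hr0 : 0 < r := by linarith
  have hs : 0 < Real.sqrt r := Real.sqrt_pos.2 hr0
  obtain ⟨ρ, hρ, hB⟩ := exists_closedBall_eq_setOf_gaussianDensity_le E hr1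
  have hpre : (fun x : E => Real.sqrt r • x) ⁻¹' Metric.closedBall 0 ρ =
      Metric.closedBall 0 (ρ / Real.sqrt r) := by
    ext x
    simpa using add_smul_mem_closedBall_iff hs x 0 ρ
  have hb := stdGaussian_closedBall_le_div_sqrt hr0 hρ hc
  rw [← hpre, ← Measure.map_apply (by fun_prop) Metric.isClosed_closedBall.measurableSet,
    ← hB] at hb
  exact l1Dist_withDensity_le volume (p := fun x => ENNReal.ofReal (gaussianDensity r x))
    (q := fun x => ENNReal.ofReal (gaussianDensity 1 x))
    (measurable_gaussianDensity r).ennreal_ofReal (measurable_gaussianDensity 1).ennreal_ofReal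
    ((stdGaussian E).map fun x => Real.sqrt r • x) (stdGaussian E)
    (map_smul_stdGaussian_eq_withDensity hr0) stdGaussian_eq_withDensity hb

end LowerBound

/-! ### Reduction of general covariances to the standard Gaussian. -/

section Multivariate

variable {m : ℕ}

-- `A` is the square root of `S`. As the lower bound holds for any invertible `A`, the covariance
-- drops out of the answer.
open scoped MatrixOrder in
theorem exists_equiv_multivariateGaussian_eq_map {S : Matrix (Fin m) (Fin m) ℝ} (hS : S.PosDef) :
    ∃ A : EuclideanSpace ℝ (Fin m) ≃L[ℝ] EuclideanSpace ℝ (Fin m),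
      ∀ h, multivariateGaussian h S =
        (stdGaussian (EuclideanSpace ℝ (Fin m))).map fun x => h + A x := by
  have hu : IsUnit (CFC.sqrt S) := (CFC.isUnit_sqrt_iff S hS.posSemidef.nonneg).2 hS.isUnit
  have hu' : IsUnit (Matrix.toEuclideanCLM (𝕜 := ℝ) (CFC.sqrt S)) := hu.map _
  refine ⟨ContinuousLinearEquiv.unitsEquiv ℝ _ hu'.unit, fun h => ?_⟩
  rfl

theorem multivariateGaussian_zero_smul_one {r : ℝ} (hr : 0 ≤ r) :
    multivariateGaussian (0 : EuclideanSpace ℝ (Fin m)) (r • (1 : Matrix (Fin m) (Fin m) ℝ)) =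
      (stdGaussian (EuclideanSpace ℝ (Fin m))).map fun x => Real.sqrt r • x := by
  refine Measure.ext_of_charFun (funext fun t => ?_)
  rw [charFun_map_smul, charFun_stdGaussian, charFun_multivariateGaussian
    (Matrix.PosSemidef.one.smul hr), ← Complex.ofReal_pow, norm_smul, mul_pow, Real.norm_eq_abs,
    sq_abs, Real.sq_sqrt hr, EuclideanSpace.real_norm_sq_eq]
  congr 1
  simp [Matrix.smul_mulVec, dotProduct, Finset.mul_sum, neg_div, sq, mul_left_comm]

end Multivariate

/-! ### Sample mean and deviations of a standard Gaussian sample. -/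

section Product

variable {E : Type*} [NormedAddCommGroup E] [InnerProductSpace ℝ E] [FiniteDimensional ℝ E]
  [MeasurableSpace E] [BorelSpace E] {r : ℕ}

/-- The normalized sum of independent standard Gaussian vectors is standard Gaussian. -/
theorem map_sum_pi_stdGaussian (hr : 1 ≤ r) :
    (Measure.pi fun _ : Fin r => stdGaussian E).map
      (fun z => (Real.sqrt r)⁻¹ • ∑ i, z i) = stdGaussian E := by
  refine Measure.ext_of_charFun (funext fun t => ?_)
  have : (fun z : Fin r → E => (Real.sqrt r)⁻¹ • ∑ i, z i) =
      (fun x => (Real.sqrt r)⁻¹ • x) ∘ fun z : Fin r → E => ∑ i, z i := rfl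
  have hr0 : (r : ℝ) ≠ 0 := by positivity
  rw [this, ← Measure.map_map (by fun_prop) (by fun_prop), charFun_map_smul,
    charFun_map_sum_pi_eq_prod]
  simp only [Finset.prod_apply, charFun_stdGaussian, Finset.prod_const, Finset.card_univ,
    Fintype.card_fin]
  rw [← Complex.exp_nat_mul, ← Complex.ofReal_pow, norm_smul, mul_pow, Real.norm_eq_abs, sq_abs,
    inv_pow, Real.sq_sqrt (by positivity)]
  congr 1
  have hr0' : (r : ℂ) ≠ 0 := by exact_mod_cast hr0
  push_cast
  field_simp

/-- Recombine the deviations of `z` from its mean with an independent vector `w`. -/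
def recombine (r : ℕ) (p : E × (Fin r → E)) (i : Fin r) : E :=
  p.2 i - (r : ℝ)⁻¹ • ∑ j, p.2 j + (Real.sqrt r)⁻¹ • p.1

theorem measurable_recombine : Measurable (recombine r : E × (Fin r → E) → Fin r → E) := by
  unfold recombine; fun_prop

/-- Mean and deviations are orthogonal components, hence independent for Gaussians, and the mean may
be replaced by a fresh copy. On characteristic functions this is Pythagoras: `hsq` splits `t` into
its mean part and its deviations `d`. -/
theorem map_recombine_stdGaussian (hr : 1 ≤ r) :
    ((stdGaussian E).prod (Measure.pi fun _ : Fin r => stdGaussian E)).map (recombine r) =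
      Measure.pi fun _ : Fin r => stdGaussian E := by
  have : IsProbabilityMeasure
      (((stdGaussian E).prod (Measure.pi fun _ : Fin r => stdGaussian E)).map (recombine r)) :=
    Measure.isProbabilityMeasure_map measurable_recombine.aemeasurable
  have hr0 : (0 : ℝ) < r := by positivity
  have hs : 0 < Real.sqrt r := Real.sqrt_pos.2 hr0
  rw [← charFun_eq_pi_iff]
  intro t
  set τ := ∑ j, t j
  set d : PiLp 2 fun _ : Fin r => E := WithLp.toLp 2 fun i => t i - (r : ℝ)⁻¹ • τ
  have hinner (p : E × (Fin r → E)) : inner ℝ (WithLp.toLp 2 (recombine r p)) t =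
      inner ℝ p.1 ((Real.sqrt r)⁻¹ • τ) + inner ℝ (WithLp.toLp 2 p.2) d := by
    simp only [PiLp.inner_apply, recombine, d, inner_add_left, inner_sub_left, inner_sub_right,
      Finset.sum_add_distrib, Finset.sum_sub_distrib, real_inner_smul_left, real_inner_smul_right,
      ← Finset.mul_sum, ← inner_sum, ← sum_inner, τ]
    ring
  rw [charFun_apply, integral_map (by fun_prop)
    (by fun_prop), integral_map measurable_recombine.aemeasurable (by fun_prop)]
  simp_rw [hinner, Complex.ofReal_add, add_mul, Complex.exp_add]
  rw [integral_prod_mul (fun w : E => Complex.exp (inner ℝ w ((Real.sqrt r)⁻¹ • τ) * Complex.I))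
    (fun z : Fin r → E => Complex.exp (inner ℝ (WithLp.toLp 2 z) d * Complex.I)), ← charFun_apply]
  have hd : ∫ z, Complex.exp (inner ℝ (WithLp.toLp 2 z) d * Complex.I)
      ∂(Measure.pi fun _ : Fin r => stdGaussian E) = ∏ i, charFun (stdGaussian E) (d i) := by
    rw [← charFun_pi, charFun_apply, integral_map (by fun_prop) (by fun_prop)]
  rw [hd]
  simp only [charFun_stdGaussian, ← Complex.exp_sum, ← Complex.exp_add]
  congr 1
  have hsq : ‖(Real.sqrt r)⁻¹ • τ‖ ^ 2 + ∑ i, ‖d i‖ ^ 2 = ∑ i, ‖t i‖ ^ 2 := by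
    have h1 : ∑ i, inner ℝ (t i) τ = ‖τ‖ ^ 2 := by
      rw [← sum_inner, real_inner_self_eq_norm_sq]
    simp only [d, norm_sub_sq_real, norm_smul, mul_pow, real_inner_smul_right,
      Finset.sum_add_distrib, Finset.sum_sub_distrib, ← Finset.mul_sum, h1, Finset.sum_const,
      Finset.card_univ, Fintype.card_fin, nsmul_eq_mul, Real.norm_eq_abs, sq_abs, inv_pow,
      Real.sq_sqrt hr0.le]
    field_simp
    ring
  rw [← Finset.sum_div, ← Finset.sum_div, Finset.sum_neg_distrib, Finset.sum_neg_distrib,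
    ← add_div, ← neg_add]
  congr 2
  exact_mod_cast hsq

end Product

/-! ### Equivalence of cloning and amplification. -/

section Cloning

variable {m r : ℕ} {S : Matrix (Fin m) (Fin m) ℝ}

/-- The sample mean is, up to scaling, a Markov map from the `r`-fold product to the amplified
Gaussian. -/
theorem map_sum_pi_multivariateGaussian (hS : S.PosDef) (hr : 1 ≤ r)
    (h : EuclideanSpace ℝ (Fin m)) :
    (Measure.pi fun _ : Fin r => multivariateGaussian h S).map
      (fun z => (Real.sqrt r)⁻¹ • ∑ i, z i) = multivariateGaussian (Real.sqrt r • h) S := by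
  obtain ⟨A, hA⟩ := exists_equiv_multivariateGaussian_eq_map hS
  simp_rw [hA]
  rw [← Measure.pi_map_pi fun _ => by fun_prop]
  conv_rhs => rw [← map_sum_pi_stdGaussian hr]
  rw [Measure.map_map (by fun_prop) (by fun_prop), Measure.map_map (by fun_prop) (by fun_prop)]
  congr 1
  ext1 z
  have hr0 : (0 : ℝ) < r := by positivity
  have : (Real.sqrt r)⁻¹ * r = Real.sqrt r := by
    rw [inv_mul_eq_div, Real.div_sqrt]
  simp only [Function.comp_apply, Finset.sum_add_distrib, Finset.sum_const, Finset.card_univ,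
    Fintype.card_fin, smul_add, map_smul, map_sum, ← Nat.cast_smul_eq_nsmul ℝ, smul_smul, this]

/-- Deviations from the mean do not feel a common shift, so they can be simulated from centred
samples without knowing `h`; the amplified vector supplies `(√r)⁻¹ √r h = h` in each coordinate. -/
theorem map_recombine_multivariateGaussian (hS : S.PosDef) (hr : 1 ≤ r)
    (h : EuclideanSpace ℝ (Fin m)) :
    ((multivariateGaussian (Real.sqrt r • h) S).prod
      (Measure.pi fun _ : Fin r => multivariateGaussian 0 S)).map (recombine r) =
      Measure.pi fun _ : Fin r => multivariateGaussian h S := by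
  obtain ⟨A, hA⟩ := exists_equiv_multivariateGaussian_eq_map hS
  simp_rw [hA]
  have hr0 : (0 : ℝ) < r := by positivity
  have hs : Real.sqrt r ≠ 0 := (Real.sqrt_pos.2 hr0).ne'
  rw [← Measure.pi_map_pi fun _ => by fun_prop, ← Measure.pi_map_pi fun _ => by fun_prop,
    Measure.map_prod_map _ _ (by fun_prop) (by fun_prop),
    Measure.map_map measurable_recombine (by fun_prop)]
  conv_rhs => rw [← map_recombine_stdGaussian hr]
  rw [Measure.map_map (by fun_prop) measurable_recombine]
  congr 1
  ext1 p
  ext1 i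
  simp only [Function.comp_apply, recombine, Prod.map_fst, Prod.map_snd, zero_add, smul_add,
    map_add, map_sub, map_smul, map_sum, smul_smul, inv_mul_cancel₀ hs, one_smul]
  abel

variable (r S) in
/-- The Markov map that turns an amplified Gaussian into `r` independent Gaussians. -/
def spreadKernel : Kernel (EuclideanSpace ℝ (Fin m)) (Fin r → EuclideanSpace ℝ (Fin m)) :=
  (Kernel.id ×ₖ Kernel.const _ (Measure.pi fun _ : Fin r => multivariateGaussian 0 S)).map
    (recombine r)

instance : IsMarkovKernel (spreadKernel r S) :=
  Kernel.IsMarkovKernel.map _ measurable_recombine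

theorem bind_spreadKernel (hS : S.PosDef) (hr : 1 ≤ r) (h : EuclideanSpace ℝ (Fin m)) :
    (multivariateGaussian (Real.sqrt r • h) S).bind (spreadKernel r S) =
      Measure.pi fun _ : Fin r => multivariateGaussian h S := by
  rw [spreadKernel, ← Measure.map_comp _ _ measurable_recombine, ← Measure.compProd_eq_comp_prod,
    Measure.compProd_const, map_recombine_multivariateGaussian hS hr]

/-- Post-composition with `spreadKernel` turns amplifiers into cloners, and with the normalized sum
cloners into amplifiers, neither increasing the loss for any `h`. -/
theorem optCloningLoss_eq_optAmplifierLoss (hS : S.PosDef) (hr : 1 ≤ r) :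
    optCloningLoss r S = optAmplifierLoss (r : ℝ) S := by
  refine le_antisymm (le_iInf₂ fun Λ hΛ => ?_) (le_iInf₂ fun Λ hΛ => ?_)
  · refine iInf₂_le_of_le (spreadKernel r S ∘ₖ Λ) inferInstance (iSup_mono fun h => ?_)
    exact l1Dist_bind_le _ _ (spreadKernel r S) _ _ Measure.comp_assoc.symm
      (bind_spreadKernel hS hr h).symm
  · have hf : Measurable fun z : Fin r → EuclideanSpace ℝ (Fin m) =>
      (Real.sqrt r)⁻¹ • ∑ i, z i := by fun_prop
    refine iInf₂_le_of_le (Λ.map fun z => (Real.sqrt r)⁻¹ • ∑ i, z i)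
      (Kernel.IsMarkovKernel.map _ hf) (iSup_mono fun h => ?_)
    have := Kernel.IsMarkovKernel.map Λ hf
    exact l1Dist_map_le _ _ hf _ _ (Measure.map_comp _ _ hf).symm
      (map_sum_pi_multivariateGaussian hS hr h).symm

end Cloning

/-! ### The optimal amplifier loss. -/

section Amplifier

variable {m : ℕ} {S : Matrix (Fin m) (Fin m) ℝ} {r : ℝ}

theorem amplifierLoss_scaling_le (hS : S.PosDef) (hr : 1 ≤ r) :
    amplifierLoss r S (scaling m (Real.sqrt r)) ≤
      l1Dist (multivariateGaussian (0 : EuclideanSpace ℝ (Fin m)) (r • 1))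
        (multivariateGaussian (0 : EuclideanSpace ℝ (Fin m)) 1) := by
  obtain ⟨A, hA⟩ := exists_equiv_multivariateGaussian_eq_map hS
  refine iSup_le fun h => ?_
  -- `√r (h + A x) = √r h + A (√r x)`: the same affine map serves both laws.
  refine l1Dist_map_le _ _ (f := fun x => Real.sqrt r • h + A x) (by fun_prop) _ _ ?_ ?_
  · rw [multivariateGaussian_zero_smul_one (by linarith), hA, scaling,
      Measure.deterministic_comp_eq_map, Measure.map_map (by fun_prop) (by fun_prop),
      Measure.map_map (by fun_prop) (by fun_prop)]
    congr 1
    ext1 x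
    simp
  · rw [multivariateGaussian_zero_one, hA]

theorem l1Dist_le_amplifierLoss (hS : S.PosDef) (hr : 1 ≤ r)
    (Λ : Kernel (EuclideanSpace ℝ (Fin m)) (EuclideanSpace ℝ (Fin m))) [IsMarkovKernel Λ] :
    l1Dist (multivariateGaussian (0 : EuclideanSpace ℝ (Fin m)) (r • 1))
        (multivariateGaussian (0 : EuclideanSpace ℝ (Fin m)) 1) ≤ amplifierLoss r S Λ := by
  obtain ⟨A, hA⟩ := exists_equiv_multivariateGaussian_eq_map hS
  have h2 : amplifierLoss r S Λ = 2 * (amplifierLoss r S Λ / 2) :=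
    (ENNReal.mul_div_cancel two_ne_zero ENNReal.ofNat_ne_top).symm
  have hloss (h : EuclideanSpace ℝ (Fin m)) :
      l1Dist ((multivariateGaussian h S).bind Λ) (multivariateGaussian (Real.sqrt r • h) S) ≤
        2 * (amplifierLoss r S Λ / 2) := by
    rw [← h2]
    exact le_iSup (fun h => l1Dist ((multivariateGaussian h S).bind Λ)
      (multivariateGaussian (Real.sqrt r • h) S)) h
  rw [h2]
  have key := l1Dist_le_of_forall_l1Dist_le (Λ := Λ) (A := A) hr
    (c := amplifierLoss r S Λ / 2) fun h => by
      have := hloss h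
      simp only [hA] at this
      exact this
  simp only [multivariateGaussian_zero_smul_one (by linarith : 0 ≤ r),
    multivariateGaussian_zero_one]
  exact key

theorem optAmplifierLoss_eq (hS : S.PosDef) (hr : 1 ≤ r) :
    optAmplifierLoss r S =
      l1Dist (multivariateGaussian (0 : EuclideanSpace ℝ (Fin m)) (r • 1))
        (multivariateGaussian (0 : EuclideanSpace ℝ (Fin m)) 1) :=
  le_antisymm (iInf₂_le_of_le _ inferInstance (amplifierLoss_scaling_le hS hr))
    (le_iInf₂ fun Λ _ => l1Dist_le_amplifierLoss hS hr Λ)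

end Amplifier

end GaussianCloning

end

theorem mainTheorem3 (m : ℕ) (S : Matrix (Fin m) (Fin m) ℝ) (hS : S.PosDef) :
    (∀ r : ℝ, 1 ≤ r →
      GaussianCloning.optAmplifierLoss r S =
          GaussianCloning.l1Dist
            (multivariateGaussian (0 : EuclideanSpace ℝ (Fin m))
              (r • (1 : Matrix (Fin m) (Fin m) ℝ)))
            (multivariateGaussian (0 : EuclideanSpace ℝ (Fin m))
              (1 : Matrix (Fin m) (Fin m) ℝ)) ∧
      GaussianCloning.amplifierLoss r S (GaussianCloning.scaling m (Real.sqrt r)) =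
        GaussianCloning.optAmplifierLoss r S) ∧
    (∀ r : ℕ, 1 ≤ r →
      GaussianCloning.optCloningLoss r S = GaussianCloning.optAmplifierLoss (r : ℝ) S) := by
  refine ⟨fun r hr => ⟨GaussianCloning.optAmplifierLoss_eq hS hr, le_antisymm ?_ ?_⟩,
    fun r hr => GaussianCloning.optCloningLoss_eq_optAmplifierLoss hS hr⟩
  · rw [GaussianCloning.optAmplifierLoss_eq hS hr]
    exact GaussianCloning.amplifierLoss_scaling_le hS hr
  · exact iInf₂_le_of_le (GaussianCloning.scaling m (Real.sqrt r)) inferInstance le_rfl
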